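/- Let $(X,T)$ be a dynamical system, i.e. $X$ is a compact metric space with metric $\rho$ and $T\colon X\to X$ is continuous. Write $\mathbb N=\{1,2,\dots\}$ and $\mathbb Z_+=\{0,1,2,\dots\}$. \textbf{Definitions.} \emph{Almost specification.} A mistake function is a function $g\colon \mathbb Z_+\times(0,\varepsilon_0)\to\mathbb N$, for some $\varepsilon_0>0$, such that $g(n,\varepsilon)\le g(n+1,\varepsilon)$ for all $n$ and $\lim_{n\to\infty} g(n,\varepsilon)/n=0$, for every $\varepsilon\in(0,\varepsilon_0)$. Let $k_g(\varepsilon)$ be the smallest $n\in\mathbb N$ with $g(m,\varepsilon)<m\varepsilon$ for all $m\ge n$. The system $(X,T)$ has the almost specification property if there is a mistake function $g$ such that for all $m\ge1$, all $\varepsilon_1,\dots,\varepsilon_m\in(0,\varepsilon_0)$, all $x_1,\dots,x_m\in X$ and all integers $0\le a_1\le b_1<a_2\le b_2<\dots<a_m\le b_m$ with $n_j:=b_j-a_j+1\ge k_g(\varepsilon_j)$ for every $j$, there is $z\in X$ such that for every $j$ the inequality $\rho(T^{i}(x_j),T^{i}(z))\le\varepsilon_j$ holds for all $i\in\{a_j,\dots,b_j\}$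 with at most $g(n_j,\varepsilon_j)$ exceptions. \emph{Measure center.} An open set $U\subset X$ is universally null if $\mu(U)=0$ for every $T$-invariant Borel probability measure $\mu$. The measure center $M$ of $(X,T)$ is the complement of the union of all universally null open sets; it is closed and $T(M)\subset M$. \emph{Entropy, topological K and u.p.e.} For an open cover $\mathcal U$ of a dynamical system $(Y,S)$ let $h(S,\mathcal U)=\lim_{n\to\infty}\frac1n\log N\big(\bigvee_{i=0}^{n-1}S^{-i}\mathcal U\big)$, where $N(\cdot)$ is the least cardinality of a finite subcover. A tuple $(y_1,\dots,y_n)\in Y^n$ is non-diagonal if at least two of its entries differ. A non-diagonal tuple is an entropy tuple if, whenever $U_p$ ($p\in\{y_1,\dots,y_n\}$) are pairwise disjoint closed neighbourhoods of the distinct points $p$ of the tuple, the open cover $\{Y\setminus U_p : p\in\{y_1,\dots,y_n\}\}$ has positive entropy. The system $(Y,S)$ is topological K if every non-diagonal tuple (of any length) is an entropy tuple, and it has uniform positive entropy (u.p.e.) if $h(S,\{U,V\})>0$ for every open cover $\{U,V\}$ of $Y$ by two non-dense sets. \emph{Horseshoe.} The system $(X,T)$ has a horseshoe if there are an integer $k>0$,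 a closed set $Z\subset X$ with $T^k(Z)\subset Z$, a finite alphabet $A$ with at least two symbols, and a continuous surjection $\pi\colon Z\to A^{\mathbb Z_+}$ with $\pi\circ T^k|_Z=\sigma\circ\pi$, where $\sigma$ is the shift. \emph{Minimality.} The system $(X,T)$ is minimal if $X$ is the only nonempty closed set $F\subset X$ with $T(F)\subset F$. \textbf{Theorem.} Let $(X,T)$ be a dynamical system with the almost specification property, and let $M$ be its measure center. Then: 1. $(M,T|_M)$ is topological K. 2. $(M,T|_M)$ has uniform positive entropy. 3. If $M$ has more than one point, then $(X,T)$ has a horseshoe. 4. If $X$ has more than one point (in particular, if $M$ has more than one point), then $(X,T)$ is not minimal. -/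

import Mathlib

open Set Filter Topology MeasureTheory

namespace TopDyn

/-! ### Entropy of an open cover -/

/-- `N(𝒰)`: the least cardinality of a finite subcover of `𝒰`. -/
noncomputable def minSubcoverCard {X : Type*} (𝒰 : Set (Set X)) : ℕ :=
  sInf {n : ℕ | ∃ 𝒱 : Finset (Set X), (𝒱 : Set (Set X)) ⊆ 𝒰 ∧ ⋃₀ (𝒱 : Set (Set X)) = univ ∧
    𝒱.card = n}

/-- The join `⋁_{i < n} T^{-i} 𝒰`: all the sets `⋂_{i < n} T^{-i} (s i)` with `s i ∈ 𝒰`. -/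
def iterJoin {X : Type*} (T : X → X) (𝒰 : Set (Set X)) (n : ℕ) : Set (Set X) :=
  {A | ∃ s : ℕ → Set X, (∀ i < n, s i ∈ 𝒰) ∧ A = ⋂ i < n, T^[i] ⁻¹' (s i)}

/-- The topological entropy `h(T, 𝒰) = lim (1/n) log N(⋁_{i < n} T^{-i} 𝒰)` of a cover.
For an open cover of a compact space the limit exists: see `tendsto_coverEntropy`. -/
noncomputable def coverEntropy {X : Type*} (T : X → X) (𝒰 : Set (Set X)) : ℝ :=
  limUnder atTop (fun n : ℕ => Real.log (minSubcoverCard (iterJoin T 𝒰 n)) / n)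

/-- `𝒰` is an open cover of `X`. -/
def IsOpenCover {X : Type*} [TopologicalSpace X] (𝒰 : Set (Set X)) : Prop :=
  (∀ U ∈ 𝒰, IsOpen U) ∧ ⋃₀ 𝒰 = univ

theorem exists_minSubcover {X : Type*} [TopologicalSpace X] [CompactSpace X]
    {𝒰 : Set (Set X)} (h : IsOpenCover 𝒰) :
    ∃ 𝒱 : Finset (Set X), (𝒱 : Set (Set X)) ⊆ 𝒰 ∧ ⋃₀ (𝒱 : Set (Set X)) = univ ∧
      𝒱.card = minSubcoverCard 𝒰 := by
  have hne : {n : ℕ | ∃ 𝒱 : Finset (Set X), (𝒱 : Set (Set X)) ⊆ 𝒰 ∧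
      ⋃₀ (𝒱 : Set (Set X)) = univ ∧ 𝒱.card = n}.Nonempty := by
    obtain ⟨t, ht, hfin, hcov⟩ := isCompact_univ.elim_finite_subcover_image (b := 𝒰)
      (c := fun U : Set X => U) h.1 (by rw [← sUnion_eq_biUnion, h.2])
    refine ⟨hfin.toFinset.card, hfin.toFinset, by simpa using ht, ?_, rfl⟩
    rw [hfin.coe_toFinset, sUnion_eq_biUnion]
    exact univ_subset_iff.1 hcov
  exact Nat.sInf_mem hne

theorem isOpenCover_iterJoin {X : Type*} [TopologicalSpace X] {T : X → X} (hT : Continuous T)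
    {𝒰 : Set (Set X)} (h : IsOpenCover 𝒰) (n : ℕ) : IsOpenCover (iterJoin T 𝒰 n) := by
  refine ⟨?_, ?_⟩
  · rintro A ⟨s, hs, rfl⟩
    exact (finite_lt_nat n).isOpen_biInter fun i hi => (h.1 _ (hs i hi)).preimage (hT.iterate i)
  · refine eq_univ_of_forall fun x => ?_
    have hx : ∀ i : ℕ, ∃ U ∈ 𝒰, T^[i] x ∈ U := fun i => by
      have : T^[i] x ∈ ⋃₀ 𝒰 := by rw [h.2]; trivial
      simpa using this
    choose s hs hxs using hx
    exact ⟨_, ⟨s, fun i _ => hs i, rfl⟩, mem_iInter₂.2 fun i _ => hxs i⟩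

theorem minSubcoverCard_iterJoin_add_le {X : Type*} [TopologicalSpace X] [CompactSpace X]
    {T : X → X} (hT : Continuous T) {𝒰 : Set (Set X)} (h : IsOpenCover 𝒰) (m n : ℕ) :
    minSubcoverCard (iterJoin T 𝒰 (m + n)) ≤
      minSubcoverCard (iterJoin T 𝒰 m) * minSubcoverCard (iterJoin T 𝒰 n) := by
  classical
  obtain ⟨V, hV, hVc, hVn⟩ := exists_minSubcover (isOpenCover_iterJoin hT h m)
  obtain ⟨W, hW, hWc, hWn⟩ := exists_minSubcover (isOpenCover_iterJoin hT h n)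
  rw [← hVn, ← hWn]
  refine le_trans (Nat.sInf_le ⟨Finset.image₂ (fun A B => A ∩ T^[m] ⁻¹' B) V W, ?_, ?_, rfl⟩)
    (Finset.card_image₂_le _ _ _)
  · intro C hC
    obtain ⟨A, hA, B, hB, rfl⟩ := Finset.mem_image₂.1 (Finset.mem_coe.1 hC)
    obtain ⟨s, hs, rfl⟩ := hV hA
    obtain ⟨t, ht, rfl⟩ := hW hB
    refine ⟨fun i => if i < m then s i else t (i - m), fun i hi => ?_, ?_⟩
    · dsimp only
      split_ifs with him
      · exact hs i him
      · exact ht _ (by omega)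
    · ext x
      simp only [mem_inter_iff, mem_iInter, mem_preimage]
      constructor
      · rintro ⟨h1, h2⟩ i hi
        split_ifs with him
        · exact h1 i him
        · have := h2 (i - m) (by omega)
          rwa [← Function.iterate_add_apply, Nat.sub_add_cancel (by omega)] at this
      · intro h1
        refine ⟨fun i hi => by simpa [hi] using h1 i (by omega), fun i hi => ?_⟩
        have := h1 (i + m) (by omega)
        simpa [Function.iterate_add_apply] using this
  · refine eq_univ_of_forall fun x => ?_
    have h1 : x ∈ ⋃₀ (V : Set (Set X)) := by rw [hVc]; trivial
    have h2 : T^[m] x ∈ ⋃₀ (W : Set (Set X)) := by rw [hWc]; trivial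
    obtain ⟨A, hA, hxA⟩ := h1
    obtain ⟨B, hB, hxB⟩ := h2
    exact ⟨A ∩ T^[m] ⁻¹' B, Finset.mem_coe.2 (Finset.mem_image₂_of_mem hA hB), hxA, hxB⟩

/-- The limit that defines the entropy of an open cover of a compact space exists. -/
theorem tendsto_coverEntropy {X : Type*} [TopologicalSpace X] [CompactSpace X]
    {T : X → X} (hT : Continuous T) {𝒰 : Set (Set X)} (h : IsOpenCover 𝒰) :
    Tendsto (fun n : ℕ => Real.log (minSubcoverCard (iterJoin T 𝒰 n)) / n) atTop
      (𝓝 (coverEntropy T 𝒰)) := by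
  have hsub : Subadditive (fun n : ℕ => Real.log (minSubcoverCard (iterJoin T 𝒰 n))) := by
    intro m n
    have hle := minSubcoverCard_iterJoin_add_le hT h m n
    dsimp only
    rcases Nat.eq_zero_or_pos (minSubcoverCard (iterJoin T 𝒰 (m + n))) with h0 | h0
    · rw [h0, Nat.cast_zero, Real.log_zero]
      exact add_nonneg (Real.log_natCast_nonneg _) (Real.log_natCast_nonneg _)
    · have hp : 0 < minSubcoverCard (iterJoin T 𝒰 m) * minSubcoverCard (iterJoin T 𝒰 n) :=
        lt_of_lt_of_le h0 hle
      have hm := Nat.pos_of_mul_pos_right hp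
      have hn := Nat.pos_of_mul_pos_left hp
      rw [← Real.log_mul (by positivity) (by positivity)]
      exact Real.log_le_log (by positivity) (by exact_mod_cast hle)
  have hb : BddBelow (range fun n : ℕ =>
      Real.log (minSubcoverCard (iterJoin T 𝒰 n)) / n) := by
    refine ⟨0, ?_⟩
    rintro _ ⟨n, rfl⟩
    exact div_nonneg (Real.log_natCast_nonneg _) (Nat.cast_nonneg _)
  exact tendsto_nhds_limUnder ⟨_, hsub.tendsto_lim hb⟩

/-! ### Uniform positive entropy and topological K -/

/-- `(X, T)` has uniform positive entropy: every open cover `{U, V}` by two non-dense sets has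
positive entropy. -/
def HasUPE {X : Type*} [TopologicalSpace X] (T : X → X) : Prop :=
  ∀ U V : Set X, IsOpenCover {U, V} → ¬ Dense U → ¬ Dense V → 0 < coverEntropy T {U, V}

/-- `(x 0, …, x (n-1))` is an entropy tuple: at least two of the points differ, and for all closed
pairwise disjoint neighbourhoods `U p` of the distinct points `p` of the tuple the open cover by
the complements of the `U p` has positive entropy. -/
def IsEntropyTuple {X : Type*} [TopologicalSpace X] (T : X → X) {n : ℕ} (x : Fin n → X) : Prop :=
  (∃ i j, x i ≠ x j) ∧
    ∀ U : X → Set X, (∀ p ∈ range x, IsClosed (U p) ∧ U p ∈ 𝓝 p) →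
      (range x).PairwiseDisjoint U →
        0 < coverEntropy T ((fun p => (U p)ᶜ) '' range x)

/-- `(X, T)` is topological K: every non-diagonal tuple is an entropy tuple. -/
def IsTopologicalK {X : Type*} [TopologicalSpace X] (T : X → X) : Prop :=
  ∀ (n : ℕ) (x : Fin n → X), (∃ i j, x i ≠ x j) → IsEntropyTuple T x

/-! ### The measure center -/

/-- The set `U` is null for every `T`-invariant Borel probability measure. -/
def IsUniversallyNull {X : Type*} [MeasurableSpace X] (T : X → X) (U : Set X) : Prop :=
  ∀ μ : Measure X, IsProbabilityMeasure μ → MeasurePreserving T μ μ → μ U = 0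

/-- The measure center: the complement of the union of all universally null open sets. -/
def measureCenter {X : Type*} [TopologicalSpace X] [MeasurableSpace X] (T : X → X) : Set X :=
  (⋃₀ {U : Set X | IsOpen U ∧ IsUniversallyNull T U})ᶜ

theorem mapsTo_measureCenter {X : Type*} [TopologicalSpace X] [MeasurableSpace X] [BorelSpace X]
    {T : X → X} (hT : Continuous T) : MapsTo T (measureCenter T) (measureCenter T) := by
  rintro x hx ⟨U, ⟨hUo, hU⟩, hxU⟩
  refine hx ⟨T ⁻¹' U, ⟨hUo.preimage hT, fun μ hμ hinv => ?_⟩, hxU⟩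
  rw [hinv.measure_preimage hUo.measurableSet.nullMeasurableSet]
  exact hU μ hμ hinv

/-- The restriction of `T` to its measure center. -/
def restrictMeasureCenter {X : Type*} [TopologicalSpace X] [MeasurableSpace X] [BorelSpace X]
    (T : X → X) (hT : Continuous T) : measureCenter T → measureCenter T :=
  (mapsTo_measureCenter hT).restrict T (measureCenter T) (measureCenter T)

/-! ### Almost specification -/

/-- `g : ℕ × (0, ε₀) → {1, 2, …}` is a mistake function; values of `g` outside
`(0, ε₀)` are irrelevant. -/
structure IsMistakeFunction (ε₀ : ℝ) (g : ℕ → ℝ → ℕ) : Prop where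
  eps_pos : 0 < ε₀
  one_le : ∀ ε, 0 < ε → ε < ε₀ → ∀ n, 1 ≤ g n ε
  mono : ∀ ε, 0 < ε → ε < ε₀ → ∀ n, g n ε ≤ g (n + 1) ε
  tendsto_zero : ∀ ε, 0 < ε → ε < ε₀ → Tendsto (fun n : ℕ => (g n ε : ℝ) / n) atTop (𝓝 0)

/-- `k_g(ε)`: the least `n ≥ 1` such that `g(m, ε) < m ε` for all `m ≥ n`. -/
noncomputable def mistakeThreshold (g : ℕ → ℝ → ℕ) (ε : ℝ) : ℕ :=
  sInf {n : ℕ | 1 ≤ n ∧ ∀ m ≥ n, (g m ε : ℝ) < m * ε}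

/-- `y` `ε`-traces over `[c, c + n)`, with at most `g(n, ε)` mistakes, the orbit segment of `x`
over `[a, a + n)`: here `Λ` is the set of times at which there is no mistake. -/
def Traces {X : Type*} [PseudoMetricSpace X] (T : X → X) (g : ℕ → ℝ → ℕ) (ε : ℝ) (n : ℕ)
    (x : X) (a : ℕ) (y : X) (c : ℕ) : Prop :=
  ∃ Λ : Finset ℕ, Λ ⊆ Finset.range n ∧ (Finset.range n \ Λ).card ≤ g n ε ∧
    ∀ i ∈ Λ, dist (T^[a + i] x) (T^[c + i] y) ≤ ε

/-- The almost specification property. The scales `ε j` range over the domain `(0, ε₀)` of the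
mistake function; extending a mistake function suitably to all `ε > 0` gives the same
property. -/
def AlmostSpecification {X : Type*} [PseudoMetricSpace X] (T : X → X) : Prop :=
  ∃ (ε₀ : ℝ) (g : ℕ → ℝ → ℕ), IsMistakeFunction ε₀ g ∧
    ∀ (m : ℕ), 1 ≤ m → ∀ (a b : Fin m → ℕ) (x : Fin m → X) (ε : Fin m → ℝ),
      (∀ j, 0 < ε j ∧ ε j < ε₀) →
      (∀ j, a j ≤ b j) →
      (∀ i j : Fin m, (i : ℕ) + 1 = j → b i < a j) →
      (∀ j, mistakeThreshold g (ε j) ≤ b j - a j + 1) →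
      ∃ z : X, ∀ j, Traces T g (ε j) (b j - a j + 1) (x j) (a j) z (a j)

/-! ### Horseshoes and minimality -/

/-- The one-sided shift. -/
def shift {A : Type*} (ξ : ℕ → A) : ℕ → A := fun i => ξ (i + 1)

/-- `(X, T)` has a horseshoe: for some `k > 0` there is a closed `Z` with `T^k(Z) ⊆ Z` such that
the full one-sided shift over a finite alphabet with at least two symbols is a factor of
`(Z, T^k|_Z)`. -/
def HasHorseshoe {X : Type*} [TopologicalSpace X] (T : X → X) : Prop :=
  ∃ (k : ℕ) (Z : Set X) (hZ : MapsTo T^[k] Z Z) (m : ℕ) (π : Z → ℕ → Fin m),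
    0 < k ∧ IsClosed Z ∧ 2 ≤ m ∧ Continuous π ∧ Function.Surjective π ∧
      ∀ z : Z, π (hZ.restrict T^[k] Z Z z) = shift (π z)

/-- `(X, T)` is minimal: the only nonempty closed `A` with `T(A) ⊆ A` is `X` itself. -/
def IsMinimalSystem {X : Type*} [TopologicalSpace X] (T : X → X) : Prop :=
  ∀ A : Set X, IsClosed A → A.Nonempty → MapsTo T A A → A = univ

end TopDyn

/-! Everything rests on a coding, `exists_coding`. Finitely many points `p i` of the measure center
have balls of positive measure for suitable invariant measures `μ i`. Under the product of the `μ
i`, some tuple `y` visits all the balls simultaneously at a proportion at least `δ > 0` of the times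
in `[0, n)`, with `δ` independent of `n`. Mistakes are sublinear in `n`, so for large `n` they are
fewer than these visits, even after multiplication by the number of points. Tracing the segments of
the `y i` in an arbitrary order, block after block, lets orbits of `X` realise every sequence of
symbols.

For topological K the orbits must lie in the measure center, where specification is not available.
Periodic sequences suffice: a closed invariant set built from the points following such a sequence
carries an invariant measure, hence meets the measure center (`exists_itinerary_mem_measureCenter`).
Pigeonhole within each block then shows that one member of the iterated cover accounts for at most
`(m - 1) ^ N` of the `m ^ N` words (`card_pow_le_minSubcoverCard_mul`), so the entropy is at least
`log (m / (m - 1)) / n`.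

U.p.e. is the case of pairs. For two distinct points the coding sets are disjoint, so reading off
symbols gives a horseshoe, and periodic sequences of many different periods contradict minimality.
-/

namespace TopDyn

/-! ### Invariant measures and the measure center -/

/-- **Krylov–Bogoliubov theorem**. -/
theorem exists_invariant_probabilityMeasure {X : Type*} [MetricSpace X] [CompactSpace X]
    [MeasurableSpace X] [BorelSpace X] [Nonempty X] {T : X → X} (hT : Continuous T) :
    ∃ μ : Measure X, IsProbabilityMeasure μ ∧ MeasurePreserving T μ μ := by
  obtain ⟨x⟩ := ‹Nonempty X›
  let ν : ℕ → Measure X := fun n =>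
    ((n + 1 : ℕ) : ENNReal)⁻¹ • ∑ i ∈ Finset.range (n + 1), Measure.dirac (T^[i] x)
  have hν : ∀ n, IsProbabilityMeasure (ν n) := fun n => by
    constructor
    simp only [ν, Measure.smul_apply, Measure.coe_finsetSum, Finset.sum_apply, measure_univ,
      Finset.sum_const, Finset.card_range, smul_eq_mul, nsmul_eq_mul, mul_one]
    exact ENNReal.inv_mul_cancel (by positivity) (ENNReal.natCast_ne_top _)
  let P : ℕ → ProbabilityMeasure X := fun n => ⟨ν n, hν n⟩
  -- The empirical measures converge along an ultrafilter, so no subsequence has to be extracted.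
  obtain ⟨μ, -, hμ⟩ := isCompact_univ.ultrafilter_le_nhds ((hyperfilter ℕ).map P)
    (by simp)
  have hlim : Tendsto P (hyperfilter ℕ : Filter ℕ) (𝓝 μ) := hμ
  rw [ProbabilityMeasure.tendsto_iff_forall_integral_tendsto] at hlim
  have hint : ∀ (f : BoundedContinuousFunction X ℝ) (n : ℕ), ∫ y, f y ∂(P n : Measure X) =
      ((n + 1 : ℕ) : ℝ)⁻¹ * ∑ i ∈ Finset.range (n + 1), f (T^[i] x) := fun f n => by
    change ∫ y, f y ∂(ν n) = _
    rw [integral_smul_measure, integral_finsetSum_measure]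
    · rw [ENNReal.toReal_inv, ENNReal.toReal_natCast, smul_eq_mul]
      simp only [integral_dirac]
    · intro i _
      exact f.integrable _
  refine ⟨μ, inferInstance, hT.measurable, ?_⟩
  have : IsProbabilityMeasure (Measure.map T (μ : Measure X)) :=
    Measure.isProbabilityMeasure_map hT.measurable.aemeasurable
  refine ext_of_forall_integral_eq_of_IsFiniteMeasure fun f => ?_
  rw [integral_map hT.measurable.aemeasurable f.continuous.aestronglyMeasurable]
  let fT : BoundedContinuousFunction X ℝ := f.compContinuous ⟨T, hT⟩
  have h1 := (hlim fT).sub (hlim f)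
  refine sub_eq_zero.1 (tendsto_nhds_unique h1 ?_)
  have hcast : Tendsto (fun n : ℕ => ((n + 1 : ℕ) : ℝ)⁻¹ * (2 * ‖f‖))
      (hyperfilter ℕ : Filter ℕ) (𝓝 0) := by
    have : Tendsto (fun n : ℕ => ((n + 1 : ℕ) : ℝ)⁻¹ * (2 * ‖f‖)) atTop (𝓝 (0 * (2 * ‖f‖))) :=
      ((tendsto_inv_atTop_zero.comp tendsto_natCast_atTop_atTop).comp
        (tendsto_add_atTop_nat 1)).mul_const _
    rw [zero_mul] at this
    exact this.mono_left Nat.hyperfilter_le_atTop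
  refine squeeze_zero_norm (fun n => ?_) hcast
  -- The two averages telescope, leaving only the boundary terms.
  have hdiff : ∫ y, fT y ∂(P n : Measure X) - ∫ y, f y ∂(P n : Measure X) =
      ((n + 1 : ℕ) : ℝ)⁻¹ * (f (T^[n + 1] x) - f x) := by
    rw [hint, hint, ← mul_sub, ← Finset.sum_sub_distrib]
    have := Finset.sum_range_sub (fun i => f (T^[i] x)) (n + 1)
    simp only [Function.iterate_zero, id_eq] at this
    rw [← this]
    congr 1
    refine Finset.sum_congr rfl fun i _ => ?_
    rw [Function.iterate_succ_apply']
    rfl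
  rw [hdiff, norm_mul, norm_inv, Real.norm_natCast]
  gcongr
  calc ‖f (T^[n + 1] x) - f x‖ ≤ ‖f (T^[n + 1] x)‖ + ‖f x‖ := norm_sub_le _ _
    _ ≤ ‖f‖ + ‖f‖ := add_le_add (f.norm_coe_le_norm _) (f.norm_coe_le_norm _)
    _ = 2 * ‖f‖ := by ring

theorem isClosed_measureCenter {X : Type*} [TopologicalSpace X] [MeasurableSpace X] (T : X → X) :
    IsClosed (measureCenter T) :=
  (isOpen_sUnion fun _ hU => hU.1).isClosed_compl

/-- Second countability reduces the union of all universally null open sets to a countable one. -/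
theorem measure_compl_measureCenter {X : Type*} [TopologicalSpace X] [SecondCountableTopology X]
    [MeasurableSpace X] {T : X → X} (μ : Measure X) [IsProbabilityMeasure μ]
    (hμ : MeasurePreserving T μ μ) : μ (measureCenter T)ᶜ = 0 := by
  obtain ⟨𝒞, hc, hsub, hU⟩ := TopologicalSpace.isOpen_sUnion_countable
    {U : Set X | IsOpen U ∧ IsUniversallyNull T U} fun _ hU => hU.1
  rw [measureCenter, compl_compl, ← hU, measure_sUnion_null_iff hc]
  exact fun U hU => (hsub hU).2 μ inferInstance hμ

/-- An invariant measure of the subsystem on `C`, pushed to `X`, gives zero mass to the complements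
of both `C` and the measure center; these cannot cover `X`. -/
theorem inter_measureCenter_nonempty {X : Type*} [MetricSpace X] [CompactSpace X]
    [MeasurableSpace X] [BorelSpace X] {T : X → X} (hT : Continuous T) {C : Set X}
    (hC : IsClosed C) (hne : C.Nonempty) (hinv : MapsTo T C C) :
    (C ∩ measureCenter T).Nonempty := by
  have : CompactSpace C := isCompact_iff_compactSpace.1 hC.isCompact
  have : Nonempty C := hne.to_subtype
  obtain ⟨μ, hμ, hpres⟩ := exists_invariant_probabilityMeasure
    (T := hinv.restrict T C C) (hT.restrict hinv)
  have hval : Measurable (Subtype.val : C → X) := measurable_subtype_coe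
  let ν : Measure X := μ.map Subtype.val
  have hν : IsProbabilityMeasure ν := Measure.isProbabilityMeasure_map hval.aemeasurable
  have hpν : MeasurePreserving T ν ν := by
    refine ⟨hT.measurable, ?_⟩
    calc ν.map T = μ.map (T ∘ Subtype.val) := Measure.map_map hT.measurable hval
      _ = (μ.map (hinv.restrict T C C)).map Subtype.val :=
        (Measure.map_map hval hpres.measurable).symm
      _ = ν := by rw [hpres.map_eq]
  have h0 : ν (measureCenter T)ᶜ = 0 := measure_compl_measureCenter ν hpν
  have h1 : ν Cᶜ = 0 := by
    rw [Measure.map_apply hval hC.measurableSet.compl]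
    simp
  by_contra hempty
  rw [not_nonempty_iff_eq_empty] at hempty
  have huniv : (univ : Set X) = Cᶜ ∪ (measureCenter T)ᶜ := by
    rw [← compl_inter, hempty, compl_empty]
  have := measure_union_null h1 h0
  rw [← huniv, measure_univ] at this
  exact one_ne_zero this

/-- Points of the measure center are approached simultaneously, with positive frequency, by
orbits of points which have preimages of all orders. -/
theorem exists_frequent_visits {X : Type*} [MetricSpace X] [CompactSpace X]
    [MeasurableSpace X] [BorelSpace X] {T : X → X} (hT : Continuous T) {ι : Type*} [Fintype ι]
    {p : ι → X} (hp : ∀ i, p i ∈ measureCenter T) {r : ℝ} (hr : 0 < r) :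
    ∃ δ : ℝ, 0 < δ ∧ ∀ n : ℕ, ∃ (y : ι → X) (S : Finset ℕ), (∀ i k, ∃ w, T^[k] w = y i) ∧
      S ⊆ Finset.range n ∧ δ * n ≤ S.card ∧ ∀ t ∈ S, ∀ i, dist (T^[t] (y i)) (p i) < r := by
  classical
  have hμ : ∀ i, ∃ μ : Measure X, IsProbabilityMeasure μ ∧ MeasurePreserving T μ μ ∧
      μ (Metric.ball (p i) r) ≠ 0 := fun i => by
    by_contra! hcon
    exact hp i ⟨Metric.ball (p i) r, ⟨Metric.isOpen_ball, fun μ h1 h2 => hcon μ h1 h2⟩,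
      Metric.mem_ball_self hr⟩
  choose μ hprob hpres hpos using hμ
  -- A product measure makes the visits to the different balls simultaneous; its mass on the product
  -- of the balls is the frequency `δ`.
  let ν : Measure (ι → X) := Measure.pi μ
  let F : (ι → X) → ι → X := fun y i => T (y i)
  have hFc : Continuous F := by fun_prop
  have hF : MeasurePreserving F ν ν := measurePreserving_pi μ μ hpres
  have hFit : ∀ (k : ℕ) (y : ι → X) (i : ι), F^[k] y i = T^[k] (y i) := fun k => by
    induction k with
    | zero => intro y i; rfl
    | succ k ih => intro y i; simp only [Function.iterate_succ_apply, ih, F]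
  let W : Set (ι → X) := univ.pi fun i => Metric.ball (p i) r
  have hWm : MeasurableSet W := MeasurableSet.univ_pi fun i => Metric.isOpen_ball.measurableSet
  have hW : ν W ≠ 0 := by
    rw [Measure.pi_pi]
    exact Finset.prod_ne_zero_iff.2 fun i _ => hpos i
  -- The preimage of the range of `F^[k]` under `F^[k]` is the whole space, so by invariance almost
  -- every point has preimages of all orders.
  have hN : ν (⋃ k : ℕ, (range F^[k])ᶜ) = 0 := by
    refine measure_iUnion_null fun k => ?_
    have hm : MeasurableSet (range F^[k]) := (isCompact_range (hFc.iterate k)).measurableSet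
    rw [← (hF.iterate k).measure_preimage hm.compl.nullMeasurableSet, preimage_compl,
      preimage_range, compl_univ, measure_empty]
  refine ⟨(ν W).toReal, ENNReal.toReal_pos hW (measure_ne_top _ _), fun n => ?_⟩
  let f : (ι → X) → ENNReal := fun y => ∑ t ∈ Finset.range n, (F^[t] ⁻¹' W).indicator 1 y
  have hmt : ∀ t, MeasurableSet (F^[t] ⁻¹' W) := fun t => (hF.iterate t).measurable hWm
  have hint : ∫⁻ y, f y ∂ν = n * ν W := by
    rw [lintegral_finsetSum _ fun t _ => measurable_one.indicator (hmt t)]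
    simp only [lintegral_indicator_one (hmt _),
      (hF.iterate _).measure_preimage hWm.nullMeasurableSet, Finset.sum_const, Finset.card_range,
      nsmul_eq_mul]
  -- Some point outside the null set has at least the mean number of visits.
  obtain ⟨y, hyN, hy⟩ := exists_notMem_null_lintegral_le (μ := ν) (f := f)
    (by rw [hint]; exact ENNReal.mul_ne_top (ENNReal.natCast_ne_top _) (measure_ne_top _ _)) hN
  refine ⟨y, (Finset.range n).filter fun t => F^[t] y ∈ W, fun i k => ?_,
    Finset.filter_subset _ _, ?_, fun t ht i => ?_⟩
  · simp only [mem_iUnion, mem_compl_iff, not_exists, not_not] at hyN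
    obtain ⟨w, hw⟩ := hyN k
    exact ⟨w i, by rw [← hFit, hw]⟩
  · have hfy : f y = ((Finset.range n).filter fun t => F^[t] y ∈ W).card := by
      simp [f, indicator_apply]
    rw [hint, hfy] at hy
    have := ENNReal.toReal_mono (ENNReal.natCast_ne_top _) hy
    rw [ENNReal.toReal_mul, ENNReal.toReal_natCast, ENNReal.toReal_natCast] at this
    rwa [mul_comm]
  · have := (Finset.mem_filter.1 ht).2 i (mem_univ i)
    rwa [hFit] at this


/-! ### Itineraries -/

/-- Under `T^n`, the orbit of `z` runs through the sets `K (ξ 0), K (ξ 1), …`. -/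
def Itinerary {X ι : Type*} (T : X → X) (n : ℕ) (K : ι → Set X) (z : X) (ξ : ℕ → ι) : Prop :=
  ∀ j, T^[j * n] z ∈ K (ξ j)

theorem shift_iterate_apply {A : Type*} (ξ : ℕ → A) (a j : ℕ) : shift^[a] ξ j = ξ (j + a) := by
  induction a generalizing ξ with
  | zero => rfl
  | succ a ih => rw [Function.iterate_succ_apply, ih]; exact congrArg ξ (by omega)

namespace Itinerary

variable {X ι : Type*} {T : X → X} {n : ℕ} {K : ι → Set X} {z : X} {ξ η : ℕ → ι}

theorem iterate (h : Itinerary T n K z ξ) (a : ℕ) :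
    Itinerary T n K (T^[a * n] z) (shift^[a] ξ) := fun j => by
  rw [← Function.iterate_add_apply, ← add_mul, shift_iterate_apply]
  exact h (j + a)

theorem unique (hK : Pairwise fun i j => Disjoint (K i) (K j)) (h : Itinerary T n K z ξ)
    (h' : Itinerary T n K z η) : ξ = η := by
  funext j
  by_contra hne
  exact disjoint_left.1 (hK hne) (h j) (h' j)

theorem isClosed [TopologicalSpace X] (hT : Continuous T) (hK : ∀ i, IsClosed (K i))
    (ξ : ℕ → ι) : IsClosed {z | Itinerary T n K z ξ} := by
  simp only [Itinerary, ofPred_forall]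
  exact isClosed_iInter fun j => (hK (ξ j)).preimage (hT.iterate _)

end Itinerary

/-- The points some iterate `T^i`, `i < n`, of which follows a sequence in the shift orbit of
`ξ`. -/
def orbitLift {X ι : Type*} (T : X → X) (n : ℕ) (K : ι → Set X) (ξ : ℕ → ι) : Set X :=
  {x | ∃ i < n, ∃ a, Itinerary T n K (T^[i] x) (shift^[a] ξ)}

section orbitLift

variable {X ι : Type*} {T : X → X} {n : ℕ} {K : ι → Set X} {ξ : ℕ → ι}

/-- Applying `T` lowers the delay `i` by one; at delay `0` it wraps around to `n - 1` and one symbol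
is consumed. -/
theorem mapsTo_orbitLift : MapsTo T (orbitLift T n K ξ) (orbitLift T n K ξ) := by
  rintro x ⟨i, hi, a, h⟩
  rcases Nat.eq_zero_or_pos i with rfl | hpos
  · refine ⟨n - 1, by omega, a + 1, ?_⟩
    have := h.iterate 1
    rw [← Function.iterate_add_apply shift, add_comm 1 a, one_mul] at this
    rwa [← Function.iterate_succ_apply, Nat.succ_eq_add_one, Nat.sub_add_cancel hi]
  · refine ⟨i - 1, by omega, a, ?_⟩
    rwa [← Function.iterate_succ_apply, Nat.succ_eq_add_one, Nat.sub_add_cancel hpos]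

/-- Periodicity leaves only finitely many shifts of `ξ`, so the union is finite. -/
theorem isClosed_orbitLift [TopologicalSpace X] (hT : Continuous T) (hK : ∀ i, IsClosed (K i))
    {N : ℕ} (hN : 0 < N) (hξ : shift^[N] ξ = ξ) : IsClosed (orbitLift T n K ξ) := by
  have : orbitLift T n K ξ =
      ⋃ i ∈ Iio n, ⋃ a ∈ Iio N, T^[i] ⁻¹' {z | Itinerary T n K z (shift^[a] ξ)} := by
    ext x
    simp only [orbitLift, mem_ofPred_eq, mem_iUnion, mem_Iio, mem_preimage, exists_prop]
    refine ⟨?_, ?_⟩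
    · rintro ⟨i, hi, a, h⟩
      refine ⟨i, hi, a % N, Nat.mod_lt _ hN, ?_⟩
      have hper : Function.IsPeriodicPt shift N ξ := hξ
      rwa [hper.iterate_mod_apply]
    · rintro ⟨i, hi, a, -, h⟩
      exact ⟨i, hi, a, h⟩
  rw [this]
  exact (finite_Iio n).isClosed_biUnion fun i _ => (finite_Iio N).isClosed_biUnion fun a _ =>
    (Itinerary.isClosed hT hK _).preimage (hT.iterate i)

theorem subset_orbitLift (hn : 0 < n) {z : X} (h : Itinerary T n K z ξ) :
    z ∈ orbitLift T n K ξ :=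
  ⟨0, hn, 0, h⟩

end orbitLift

theorem exists_itinerary_mem_measureCenter {X : Type*} [MetricSpace X] [CompactSpace X]
    [MeasurableSpace X] [BorelSpace X] {T : X → X} (hT : Continuous T) {ι : Type*} {n : ℕ}
    (hn : 0 < n) {K : ι → Set X} (hK : ∀ i, IsClosed (K i)) {ξ : ℕ → ι} {N : ℕ} (hN : 0 < N)
    (hξ : shift^[N] ξ = ξ) (hex : ∃ z, Itinerary T n K z ξ) :
    ∃ z ∈ measureCenter T, Itinerary T n K z ξ := by
  obtain ⟨z, hz⟩ := hex
  obtain ⟨x, ⟨i, -, a, hx⟩, hxM⟩ := inter_measureCenter_nonempty hT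
    (isClosed_orbitLift hT hK hN hξ) ⟨z, subset_orbitLift hn hz⟩ mapsTo_orbitLift
  have hmem : ∀ k, T^[k] x ∈ measureCenter T := fun k => (mapsTo_measureCenter hT).iterate k hxM
  -- Advancing `N * a - a` further blocks turns `shift^[a] ξ` into `shift^[N * a] ξ`, which is `ξ`.
  have h := hx.iterate (N * a - a)
  rw [← Function.iterate_add_apply, ← Function.iterate_add_apply,
    Nat.sub_add_cancel (Nat.le_mul_of_pos_left a hN), Function.iterate_mul,
    Function.iterate_fixed hξ a] at h
  exact ⟨_, hmem _, h⟩

/-! ### Coding by almost specification -/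

/-- Membership in finitely many open sets persists nearby, so the count is lower semicontinuous. -/
theorem isClosed_setOf_card_filter_le {X : Type*} [TopologicalSpace X] (I : Finset ℕ) (k : ℕ)
    {V : ℕ → Set X} (hV : ∀ t, IsOpen (V t)) [∀ z, DecidablePred fun t => z ∈ V t] :
    IsClosed {z | (I.filter fun t => z ∈ V t).card ≤ k} := by
  rw [← isOpen_compl_iff, isOpen_iff_mem_nhds]
  intro z hz
  have hmem : (⋂ t ∈ I.filter fun t => z ∈ V t, V t) ∈ 𝓝 z :=
    (Filter.biInter_finset_mem _).2 fun t ht => (hV t).mem_nhds (Finset.mem_filter.1 ht).2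
  filter_upwards [hmem] with w hw
  simp only [mem_compl_iff, mem_ofPred_eq, not_le] at hz ⊢
  refine hz.trans_le (Finset.card_le_card fun t ht => ?_)
  exact Finset.mem_filter.2 ⟨(Finset.mem_filter.1 ht).1, mem_iInter₂.1 hw t ht⟩

/-- Specification handles finitely many segments at a time; compactness passes to infinite
sequences. -/
theorem exists_itinerary_of_prefixes {X : Type*} [TopologicalSpace X] [CompactSpace X]
    {T : X → X} (hT : Continuous T) {ι : Type*} {n : ℕ} {K : ι → Set X}
    (hK : ∀ i, IsClosed (K i)) (ξ : ℕ → ι)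
    (h : ∀ m : ℕ, ∃ z, ∀ j ≤ m, T^[j * n] z ∈ K (ξ j)) : ∃ z, Itinerary T n K z ξ := by
  have hcl : ∀ m : ℕ, IsClosed {z | ∀ j ≤ m, T^[j * n] z ∈ K (ξ j)} := fun m => by
    simp only [ofPred_forall]
    exact isClosed_iInter fun j => isClosed_iInter fun _ => (hK _).preimage (hT.iterate _)
  obtain ⟨z, hz⟩ := IsCompact.nonempty_iInter_of_sequence_nonempty_isCompact_isClosed
    (fun m : ℕ => {z | ∀ j ≤ m, T^[j * n] z ∈ K (ξ j)})
    (fun m z hz j hj => hz j (by omega)) h (hcl 0).isCompact hcl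
  exact ⟨z, fun j => mem_iInter.1 hz j j le_rfl⟩

/-- Under almost specification, finitely many points of the measure center can be visited by
blocks of orbits in any prescribed order, at all but `k` of the times in `S`. -/
theorem AlmostSpecification.exists_coding {X : Type*} [MetricSpace X] [CompactSpace X]
    [MeasurableSpace X] [BorelSpace X] {T : X → X} (hT : Continuous T)
    (hspec : AlmostSpecification T) {ι : Type*} [Fintype ι] {p : ι → X}
    (hp : ∀ i, p i ∈ measureCenter T) {r : ℝ} (hr : 0 < r) :
    ∃ (n : ℕ) (K : ι → Set X) (S : Finset ℕ) (k : ℕ), 0 < n ∧ S ⊆ Finset.range n ∧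
      Fintype.card ι * k < S.card ∧ (∀ i, IsClosed (K i)) ∧
      (∀ i, ∀ z ∈ K i, (S.filter fun t => ¬ dist (T^[t] z) (p i) < r).card ≤ k) ∧
      ∀ ξ, ∃ z, Itinerary T n K z ξ := by
  classical
  obtain ⟨ε₀, g, hg, hs⟩ := hspec
  obtain ⟨δ, hδ, hvis⟩ := exists_frequent_visits hT hp (half_pos hr)
  have hε₀ := hg.eps_pos
  set ε : ℝ := min (r / 2) (ε₀ / 2) with hε
  have hεpos : 0 < ε := by positivity
  have hεlt : ε < ε₀ := (min_le_right _ _).trans_lt (half_lt_self hε₀)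
  have hlim : Tendsto (fun n : ℕ => (Fintype.card ι : ℝ) * ((g n ε : ℝ) / n)) atTop (𝓝 0) := by
    simpa using (hg.tendsto_zero ε hεpos hεlt).const_mul (Fintype.card ι : ℝ)
  obtain ⟨n, ⟨hn, hthr⟩, hn0⟩ := (((hlim.eventually_lt_const hδ).and
    (eventually_ge_atTop (mistakeThreshold g ε))).and (eventually_gt_atTop 0)).exists
  obtain ⟨y, S, hcore, hSn, hS, hSy⟩ := hvis n
  -- The set `K i` consists of the points tracing `y i` over `[0, n)` with at most `g n ε` mistakes;
  -- a mistake is a strict inequality, hence an open condition.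
  let K : ι → Set X := fun i =>
    {z | ((Finset.range n).filter fun t => z ∈ {w | ε < dist (T^[t] (y i)) (T^[t] w)}).card
      ≤ g n ε}
  have hKc : ∀ i, IsClosed (K i) := fun i => isClosed_setOf_card_filter_le _ _ fun t =>
    isOpen_lt continuous_const (continuous_const.dist (hT.iterate t))
  refine ⟨n, K, S, g n ε, hn0, hSn, ?_, hKc, fun i z hz => ?_, fun ξ => ?_⟩
  · have hn' : (0 : ℝ) < n := by exact_mod_cast hn0
    rw [← mul_div_assoc, div_lt_iff₀ hn'] at hn
    exact_mod_cast hn.trans_le hS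
  · refine (Finset.card_le_card fun t ht => ?_).trans hz
    obtain ⟨htS, ht⟩ := Finset.mem_filter.1 ht
    refine Finset.mem_filter.2 ⟨hSn htS, ?_⟩
    by_contra hcon
    simp only [mem_ofPred_eq, not_lt] at hcon
    refine ht ?_
    calc dist (T^[t] z) (p i) ≤ dist (T^[t] (y i)) (T^[t] z) + dist (T^[t] (y i)) (p i) := by
          rw [dist_comm (T^[t] (y i)) (T^[t] z)]; exact dist_triangle _ _ _
      _ < r / 2 + r / 2 :=
          add_lt_add_of_le_of_lt (hcon.trans (min_le_left _ _)) (hSy t htS i)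
      _ = r := add_halves r
  · refine exists_itinerary_of_prefixes hT hKc ξ fun m => ?_
    -- Specification compares `x j` and `z` at the same absolute times, so `x j` must reach `y (ξ
    -- j)` at time `j * n`. This is why preimages of all orders are required.
    choose x hx using fun j : Fin (m + 1) => hcore (ξ j) (j * n)
    have hlen : ∀ j : Fin (m + 1), (j : ℕ) * n + (n - 1) - j * n + 1 = n := fun j => by omega
    obtain ⟨z, hz⟩ := hs (m + 1) (by omega) (fun j => j * n) (fun j => j * n + (n - 1)) x
      (fun _ => ε) (fun _ => ⟨hεpos, hεlt⟩) (fun j => by omega)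
      (fun i j hij => by
        have : (j : ℕ) * n = i * n + n := by rw [← hij]; ring
        omega)
      (fun j => by rw [hlen]; exact hthr)
    refine ⟨z, fun j hj => ?_⟩
    obtain ⟨Λ, hΛ, hcard, hdist⟩ := hz ⟨j, by omega⟩
    rw [hlen] at hΛ hcard
    refine (Finset.card_le_card fun t ht => ?_).trans hcard
    obtain ⟨htn, ht⟩ := Finset.mem_filter.1 ht
    refine Finset.mem_sdiff.2 ⟨htn, fun htΛ => ?_⟩
    have h1 := hdist t htΛ
    have h2 := hx ⟨j, by omega⟩
    dsimp only at h1 h2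
    rw [add_comm (j * n), Function.iterate_add_apply, Function.iterate_add_apply, h2] at h1
    exact absurd ht (not_lt.2 h1)

/-- The pieces of a coding at well separated points are pairwise disjoint. -/
theorem pairwise_disjoint_of_visits {X : Type*} [PseudoMetricSpace X] {T : X → X} {ι : Type*}
    [Fintype ι] {p : ι → X} {r : ℝ} {K : ι → Set X} {S : Finset ℕ} {k : ℕ}
    (hp : Pairwise fun i j => 2 * r ≤ dist (p i) (p j)) (hk : Fintype.card ι * k < S.card)
    (hK : ∀ i, ∀ z ∈ K i, (S.filter fun t => ¬ dist (T^[t] z) (p i) < r).card ≤ k) :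
    Pairwise fun i j => Disjoint (K i) (K j) := by
  classical
  intro i j hij
  refine disjoint_left.2 fun z hi hj => ?_
  -- At a time in neither exceptional set the orbit would be within `r` of both points. Two sets of
  -- size at most `k` cannot cover `S`, since `2 * k < S.card`.
  have hcov : S ⊆ (S.filter fun t => ¬ dist (T^[t] z) (p i) < r) ∪
      S.filter fun t => ¬ dist (T^[t] z) (p j) < r := fun t ht => by
    by_contra hcon
    simp only [Finset.mem_union, Finset.mem_filter, ht, true_and, not_or, not_not] at hcon
    have := hp hij
    have := dist_triangle_left (p i) (p j) (T^[t] z)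
    linarith [hcon.1, hcon.2]
  have h1 := (Finset.card_le_card hcov).trans (Finset.card_union_le _ _)
  have h2 : 1 < Fintype.card ι := Fintype.one_lt_card_iff.2 ⟨i, j, hij⟩
  have h3 : 2 * k ≤ Fintype.card ι * k := Nat.mul_le_mul_right k h2
  have := hK i z hi
  have := hK j z hj
  omega


/-! ### Positive entropy on the measure center -/

/-- If every word over `ι` is followed by some orbit of `Y`, and orbits following the symbol `i`
are in `U i` at all but `k` of the times in `S`, where `k · |ι| < |S|`, then the cover by the
complements of the `U i` has large subcovers only. -/
theorem card_pow_le_minSubcoverCard_mul {Y : Type*} [TopologicalSpace Y] [CompactSpace Y]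
    {T : Y → Y} (hT : Continuous T) {ι : Type*} [Fintype ι] [Nonempty ι] {U : ι → Set Y}
    (hU : IsOpenCover (range fun i => (U i)ᶜ)) {n N k : ℕ} {S : Finset ℕ}
    (hSn : S ⊆ Finset.range n) (hS : Fintype.card ι * k < S.card)
    [∀ i z, DecidablePred fun t => T^[t] z ∉ U i]
    (hex : ∀ w : Fin N → ι, ∃ z, ∀ j : Fin N,
      (S.filter fun t => T^[t] (T^[j * n] z) ∉ U (w j)).card ≤ k) :
    Fintype.card ι ^ N ≤ minSubcoverCard (iterJoin T (range fun i => (U i)ᶜ) (N * n)) *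
      (Fintype.card ι - 1) ^ N := by
  classical
  obtain ⟨𝒱, hsub, hcov, hcard⟩ := exists_minSubcover (isOpenCover_iterJoin hT hU (N * n))
  choose z hz using hex
  have hV : ∀ w, ∃ A ∈ 𝒱, z w ∈ A := fun w => by
    have : z w ∈ ⋃₀ (𝒱 : Set (Set Y)) := by rw [hcov]; trivial
    simpa using this
  choose A hA hzA using hV
  have hfib : ∀ B ∈ 𝒱, ((Finset.univ : Finset (Fin N → ι)).filter fun w => A w = B).card ≤
      (Fintype.card ι - 1) ^ N := by
    intro B hB
    obtain ⟨s, hs, rfl⟩ := hsub hB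
    have hq : ∀ i, ∃ q : ι, i < N * n → s i = (U q)ᶜ := fun i => by
      by_cases hi : i < N * n
      · obtain ⟨q, hq⟩ := hs i hi
        exact ⟨q, fun _ => hq.symm⟩
      · exact ⟨Classical.arbitrary ι, fun h => absurd h hi⟩
    choose q hq using hq
    -- Since `|S| > k · |ι|`, in each block some symbol `c` labels the cover at more than `k` times
    -- of `S`. A word coded by `B` cannot have `c` there: its orbit would miss `U c` too often.
    have hc : ∀ j : Fin N, ∃ c : ι, k < (S.filter fun t => q (t + j * n) = c).card := fun j => by
      obtain ⟨c, -, hc⟩ := Finset.exists_lt_card_fiber_of_mul_lt_card_of_maps_to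
        (s := S) (t := Finset.univ) (f := fun t => q (t + j * n)) (n := k)
        (fun _ _ => Finset.mem_univ _) (by simpa using hS)
      exact ⟨c, hc⟩
    choose c hc using hc
    calc _ ≤ (Fintype.piFinset fun j : Fin N => Finset.univ.erase (c j)).card := by
          refine Finset.card_le_card fun w hw => ?_
          rw [Fintype.mem_piFinset]
          intro j
          refine Finset.mem_erase.2 ⟨fun hwj => ?_, Finset.mem_univ _⟩
          have hzw := hzA w
          rw [(Finset.mem_filter.1 hw).2] at hzw
          refine absurd (hz w j) (not_le.2 ((hc j).trans_le (Finset.card_le_card fun t ht => ?_)))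
          obtain ⟨htS, ht⟩ := Finset.mem_filter.1 ht
          have htn := Finset.mem_range.1 (hSn htS)
          have hlt : t + j * n < N * n := by
            have : ((j : ℕ) + 1) * n ≤ N * n := Nat.mul_le_mul_right n j.2
            rw [add_mul] at this
            omega
          refine Finset.mem_filter.2 ⟨htS, ?_⟩
          have := mem_iInter₂.1 hzw _ hlt
          rw [hq _ hlt, mem_preimage, Function.iterate_add_apply, ht] at this
          rw [hwj]
          exact this
      _ = (Fintype.card ι - 1) ^ N := by
          simp [Fintype.card_piFinset, Finset.card_erase_of_mem]
  rw [← hcard, mul_comm]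
  calc Fintype.card ι ^ N = (Finset.univ : Finset (Fin N → ι)).card := by simp
    _ ≤ _ := Finset.card_le_mul_card_image_of_maps_to (fun w _ => hA w) _ hfib

theorem coverEntropy_pos_of_visits {Y : Type*} [TopologicalSpace Y] [CompactSpace Y]
    {T : Y → Y} (hT : Continuous T) {ι : Type*} [Fintype ι] [Nontrivial ι] {U : ι → Set Y}
    (hU : IsOpenCover (range fun i => (U i)ᶜ)) {n k : ℕ} (hn : 0 < n) {S : Finset ℕ}
    (hSn : S ⊆ Finset.range n) (hS : Fintype.card ι * k < S.card)
    [∀ i z, DecidablePred fun t => T^[t] z ∉ U i]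
    (hex : ∀ (N : ℕ) (w : Fin N → ι), ∃ z, ∀ j : Fin N,
      (S.filter fun t => T^[t] (T^[j * n] z) ∉ U (w j)).card ≤ k) :
    0 < coverEntropy T (range fun i => (U i)ᶜ) := by
  set m := Fintype.card ι with hm
  have hm2 : 1 < m := Fintype.one_lt_card
  have hm1 : (0 : ℝ) < ((m - 1 : ℕ) : ℝ) := by exact_mod_cast Nat.sub_pos_of_lt hm2
  have hratio : 1 < (m : ℝ) / ((m - 1 : ℕ) : ℝ) := by
    rw [one_lt_div hm1]
    exact_mod_cast Nat.sub_lt (by omega) one_pos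
  have hn' : (0 : ℝ) < n := by exact_mod_cast hn
  refine (div_pos (Real.log_pos hratio) hn').trans_le ?_
  -- As the limit exists, it may be computed along the multiples of `n`.
  have hlim := (tendsto_coverEntropy hT hU).comp (tendsto_id.atTop_mul_const' hn)
  refine ge_of_tendsto hlim ((eventually_gt_atTop 0).mono fun N hN => ?_)
  have hN' : (0 : ℝ) < N := by exact_mod_cast hN
  have hle := card_pow_le_minSubcoverCard_mul hT hU hSn hS (hex N)
  simp only [Function.comp_apply, id_eq]
  set L := minSubcoverCard (iterJoin T (range fun i => (U i)ᶜ) (N * n))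
  have hle' : ((m : ℝ) / ((m - 1 : ℕ) : ℝ)) ^ N ≤ L := by
    rw [div_pow, div_le_iff₀ (pow_pos hm1 N)]
    exact_mod_cast hle
  have hlog := Real.log_le_log (by positivity) hle'
  rw [Real.log_pow] at hlog
  push_cast
  rw [div_le_div_iff₀ hn' (by positivity)]
  nlinarith [mul_le_mul_of_nonneg_right hlog hn'.le]

theorem coe_restrictMeasureCenter_iterate {X : Type*} [TopologicalSpace X] [MeasurableSpace X]
    [BorelSpace X] {T : X → X} (hT : Continuous T) (k : ℕ) (z : measureCenter T) :
    ((restrictMeasureCenter T hT)^[k] z : X) = T^[k] z := by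
  have h : Function.Semiconj (Subtype.val : measureCenter T → X) (restrictMeasureCenter T hT) T :=
    fun _ => rfl
  exact (h.iterate_right k).eq z

theorem continuous_restrictMeasureCenter {X : Type*} [TopologicalSpace X] [MeasurableSpace X]
    [BorelSpace X] {T : X → X} (hT : Continuous T) : Continuous (restrictMeasureCenter T hT) :=
  hT.restrict _

theorem AlmostSpecification.isTopologicalK {X : Type*} [MetricSpace X] [CompactSpace X]
    [MeasurableSpace X] [BorelSpace X] {T : X → X} (hT : Continuous T)
    (hspec : AlmostSpecification T) : IsTopologicalK (restrictMeasureCenter T hT) := by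
  classical
  intro l x hx
  refine ⟨hx, fun U hU hdisj => ?_⟩
  have : CompactSpace (measureCenter T) :=
    isCompact_iff_compactSpace.1 (isClosed_measureCenter T).isCompact
  let ι := range x
  have : Fintype ι := (finite_range x).fintype
  have hnt : Nontrivial ι := by
    obtain ⟨i, j, hij⟩ := hx
    exact ⟨⟨_, mem_range_self i⟩, ⟨_, mem_range_self j⟩, fun h => hij (congrArg Subtype.val h)⟩
  let V : ι → Set (measureCenter T) := fun i => U i
  have himg : (fun p => (U p)ᶜ) '' range x = range fun i : ι => (V i)ᶜ := image_eq_range _ _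
  have hcover : IsOpenCover (range fun i : ι => (V i)ᶜ) := by
    refine ⟨?_, ?_⟩
    · rintro _ ⟨i, rfl⟩
      exact (hU i i.2).1.isOpen_compl
    · obtain ⟨i, j, hij⟩ := hnt
      refine eq_univ_of_forall fun z => ?_
      rw [sUnion_range, mem_iUnion]
      by_contra! hcon
      have hne : (i : measureCenter T) ≠ j := fun h => hij (Subtype.ext h)
      exact disjoint_left.1 (hdisj i.2 j.2 hne) (not_not.1 (hcon i)) (not_not.1 (hcon j))
  rw [himg]
  have hball : ∀ i : ι, ∃ r > 0, Metric.ball (i : measureCenter T) r ⊆ V i := fun i =>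
    Metric.mem_nhds_iff.1 (hU i i.2).2
  choose r hr hrV using hball
  obtain ⟨ρ, hρ, hρr⟩ : ∃ ρ > 0, ∀ i, ρ ≤ r i := by
    obtain ⟨i₀, hi₀⟩ := Finite.exists_min r
    exact ⟨r i₀, hr i₀, hi₀⟩
  obtain ⟨n, K, S, k, hn, hSn, hS, hKc, hK, hex⟩ := hspec.exists_coding hT
    (p := fun i : ι => ((i : measureCenter T) : X)) (fun i => i.1.2) hρ
  refine coverEntropy_pos_of_visits (continuous_restrictMeasureCenter hT) hcover hn hSn hS
    fun N w => ?_
  rcases Nat.eq_zero_or_pos N with rfl | hN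
  · exact ⟨(Classical.arbitrary ι : ι), fun j => j.elim0⟩
  -- Entropy only needs finite words; the periodic extension is what allows the itinerary to be
  -- found inside the measure center.
  let ξ : ℕ → ι := fun j => w ⟨j % N, Nat.mod_lt _ hN⟩
  have hξ : shift^[N] ξ = ξ := by
    funext j
    rw [shift_iterate_apply]
    simp [ξ]
  obtain ⟨z, hzM, hz⟩ := exists_itinerary_mem_measureCenter hT hn hKc hN hξ (hex ξ)
  refine ⟨⟨z, hzM⟩, fun j => ?_⟩
  have hzj := hz j
  have hξj : ξ j = w j := by simp [ξ, Nat.mod_eq_of_lt j.2]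
  rw [hξj] at hzj
  refine (Finset.card_le_card fun t ht => ?_).trans (hK _ _ hzj)
  obtain ⟨htS, ht⟩ := Finset.mem_filter.1 ht
  refine Finset.mem_filter.2 ⟨htS, fun hlt => ht (hrV _ ?_)⟩
  rw [Metric.mem_ball, Subtype.dist_eq, coe_restrictMeasureCenter_iterate,
    coe_restrictMeasureCenter_iterate]
  exact hlt.trans_le (hρr _)

theorem IsTopologicalK.hasUPE {Y : Type*} [TopologicalSpace Y] {T : Y → Y}
    (h : IsTopologicalK T) : HasUPE T := by
  classical
  intro U V hUV hU hV
  have hint : ∀ W : Set Y, ¬ Dense W → (interior Wᶜ).Nonempty := fun W hW => by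
    rwa [nonempty_iff_ne_empty, Ne, interior_eq_empty_iff_dense_compl, compl_compl]
  obtain ⟨p, hp⟩ := hint U hU
  obtain ⟨q, hq⟩ := hint V hV
  have hdisj : Disjoint Uᶜ Vᶜ := by
    rw [disjoint_iff_inter_eq_empty, ← compl_union, ← sUnion_pair, hUV.2, compl_univ]
  have hpq : p ≠ q := by
    rintro rfl
    exact disjoint_left.1 hdisj (interior_subset hp) (interior_subset hq)
  have hrange : range ![p, q] = {p, q} := by simp [Matrix.range_cons, pair_comm]
  obtain ⟨-, hent⟩ := h 2 ![p, q] ⟨0, 1, by simpa using hpq⟩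
  -- The complements of `U` and `V` are themselves disjoint closed neighbourhoods of `p` and `q`;
  -- values away from these two points do not matter.
  have := hent (fun y => if y = p then Uᶜ else Vᶜ) ?_ ?_
  · rw [hrange, image_pair] at this
    simpa [hpq.symm] using this
  · rw [hrange]
    rintro y (rfl | rfl)
    · simpa using ⟨hUV.1 U (by simp), mem_interior_iff_mem_nhds.1 hp⟩
    · simpa [hpq.symm] using ⟨hUV.1 V (by simp), mem_interior_iff_mem_nhds.1 hq⟩
  · rw [hrange, pairwiseDisjoint_insert_of_notMem (by simpa using hpq)]
    simpa [hpq.symm] using hdisj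

/-! ### Horseshoes and minimality -/

theorem AlmostSpecification.exists_disjoint_coding {X : Type*} [MetricSpace X] [CompactSpace X]
    [MeasurableSpace X] [BorelSpace X] {T : X → X} (hT : Continuous T)
    (hspec : AlmostSpecification T) (hM : (measureCenter T).Nontrivial) :
    ∃ (n : ℕ) (K : Fin 2 → Set X), 0 < n ∧ (∀ i, IsClosed (K i)) ∧
      (Pairwise fun i j => Disjoint (K i) (K j)) ∧ ∀ ξ, ∃ z, Itinerary T n K z ξ := by
  classical
  obtain ⟨p, hp, q, hq, hpq⟩ := hM
  obtain ⟨n, K, S, k, hn, -, hS, hKc, hK, hex⟩ := hspec.exists_coding hT (p := ![p, q])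
    (by simp [Fin.forall_fin_two, hp, hq]) (half_pos (dist_pos.2 hpq))
  refine ⟨n, K, hn, hKc, pairwise_disjoint_of_visits (fun i j hij => ?_) hS hK, hex⟩
  rw [mul_div_cancel₀ _ two_ne_zero]
  fin_cases i <;> fin_cases j <;> simp_all [dist_comm]

theorem AlmostSpecification.hasHorseshoe {X : Type*} [MetricSpace X] [CompactSpace X]
    [MeasurableSpace X] [BorelSpace X] {T : X → X} (hT : Continuous T)
    (hspec : AlmostSpecification T) (hM : (measureCenter T).Nontrivial) : HasHorseshoe T := by
  obtain ⟨n, K, hn, hKc, hdisj, hex⟩ := hspec.exists_disjoint_coding hT hM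
  -- On `Z` the symbol of each block is unique because the `K i` are disjoint, which makes the
  -- coding map continuous and equivariant.
  let Z : Set X := {z | ∀ j : ℕ, ∃ i, T^[j * n] z ∈ K i}
  have hZc : IsClosed Z := by
    simp only [Z, ofPred_forall, ofPred_exists]
    exact isClosed_iInter fun j => isClosed_iUnion_of_finite fun i =>
      (hKc i).preimage (hT.iterate _)
  have hit : ∀ z : Z, ∃ ξ, Itinerary T n K z ξ := fun z => Classical.axiom_of_choice z.2
  choose π hπ using hit
  have hshift : ∀ {z ξ}, Itinerary T n K z ξ → Itinerary T n K (T^[n] z) (shift ξ) :=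
    fun {z ξ} h => by simpa using h.iterate 1
  have hZ : MapsTo T^[n] Z Z := fun z hz j => ⟨_, hshift (hπ ⟨z, hz⟩) j⟩
  refine ⟨n, Z, hZ, 2, π, hn, hZc, le_rfl, ?_, fun ξ => ?_, fun z => ?_⟩
  · refine continuous_pi fun j => ?_
    rw [continuous_iff_isClosed]
    intro F _
    have : (fun z => π z j) ⁻¹' F = ⋃ i ∈ F, (fun z : Z => T^[j * n] z) ⁻¹' K i := by
      ext z
      simp only [mem_preimage, mem_iUnion, exists_prop]
      refine ⟨fun h => ⟨_, h, hπ z j⟩, ?_⟩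
      rintro ⟨i, hi, h⟩
      by_cases hne : π z j = i
      · rwa [hne]
      · exact absurd h (disjoint_left.1 (hdisj hne) (hπ z j))
    rw [this]
    exact (toFinite F).isClosed_biUnion fun i _ =>
      (hKc i).preimage ((hT.iterate _).comp continuous_subtype_val)
  · obtain ⟨z, hz⟩ := hex ξ
    have hzZ : z ∈ Z := fun j => ⟨_, hz j⟩
    exact ⟨⟨z, hzZ⟩, (hπ ⟨z, hzZ⟩).unique hdisj hz⟩
  · exact (hπ _).unique hdisj (hshift (hπ z))

/-- The periodic sequences with exactly one marked symbol in each period have disjoint orbits for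
different periods. -/
theorem dvd_of_shift_iterate_eq {A : Type*} {u v : A} (huv : u ≠ v) {k l : ℕ} {a b : ℕ}
    (h : shift^[a] (fun j => if k + 1 ∣ j then u else v) =
      shift^[b] fun j => if l + 1 ∣ j then u else v) : l + 1 ∣ k + 1 := by
  have hiff : ∀ j, k + 1 ∣ j + a ↔ l + 1 ∣ j + b := fun j => by
    have := congrFun h j
    simp only [shift_iterate_apply] at this
    split_ifs at this <;> simp_all
  -- Two consecutive marks of the first sequence, at distance `k + 1`, are also marks of the second,
  -- so `l + 1` divides their distance.
  have hdvd : k + 1 ∣ k * a + a := ⟨a, by ring⟩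
  have h1 := (hiff _).1 hdvd
  have h2 := (hiff (k * a + (k + 1))).1 (by
    rw [add_right_comm]; exact hdvd.add (dvd_refl _))
  rw [add_right_comm] at h2
  exact (Nat.dvd_add_right h1).1 h2

theorem AlmostSpecification.not_isMinimalSystem {X : Type*} [MetricSpace X] [CompactSpace X]
    [MeasurableSpace X] [BorelSpace X] {T : X → X} (hT : Continuous T)
    (hspec : AlmostSpecification T) (hX : Nontrivial X) : ¬ IsMinimalSystem T := by
  intro hmin
  obtain ⟨x⟩ : Nonempty X := inferInstance
  have hne : (measureCenter T).Nonempty := by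
    simpa using inter_measureCenter_nonempty hT isClosed_univ univ_nonempty (mapsTo_univ T univ)
  have hM : (measureCenter T).Nontrivial := by
    rw [hmin _ (isClosed_measureCenter T) hne (mapsTo_measureCenter hT)]
    exact nontrivial_univ
  obtain ⟨n, K, hn, hKc, hdisj, hex⟩ := hspec.exists_disjoint_coding hT hM
  let ξ : ℕ → ℕ → Fin 2 := fun k j => if k + 1 ∣ j then 1 else 0
  have hξ : ∀ k, shift^[k + 1] (ξ k) = ξ k := fun k => by
    funext j
    simp [shift_iterate_apply, ξ]
  -- By minimality the closed invariant set attached to each periodic sequence is all of `X`, so it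
  -- contains the one point `x`.
  have hlift : ∀ k, x ∈ orbitLift T n K (ξ k) := fun k => by
    obtain ⟨z, hz⟩ := hex (ξ k)
    rw [hmin _ (isClosed_orbitLift hT hKc k.succ_pos (hξ k)) ⟨z, subset_orbitLift hn hz⟩
      mapsTo_orbitLift]
    trivial
  choose i hi a ha using hlift
  -- Among `n + 1` periods two share the same delay `i < n`; then a single point follows shifts of
  -- both sequences, which forces equal periods.
  obtain ⟨k, l, hkl, h⟩ := Fintype.exists_ne_map_eq_of_card_lt
    (fun k : Fin (n + 1) => (⟨i k, hi k⟩ : Fin n)) (by simp)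
  have hik : i k = i l := congrArg Fin.val h
  have hl := ha l
  rw [← hik] at hl
  have heq := (ha k).unique hdisj hl
  have hdvd := Nat.dvd_antisymm (dvd_of_shift_iterate_eq (by decide) heq)
    (dvd_of_shift_iterate_eq (by decide) heq.symm)
  exact hkl (Fin.ext (by omega))

end TopDyn

theorem mainTheorem3 {X : Type*} [MetricSpace X] [CompactSpace X] [MeasurableSpace X]
    [BorelSpace X] (T : X → X) (hT : Continuous T) (hspec : TopDyn.AlmostSpecification T) :
    TopDyn.IsTopologicalK (TopDyn.restrictMeasureCenter T hT) ∧
    TopDyn.HasUPE (TopDyn.restrictMeasureCenter T hT) ∧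
    ((TopDyn.measureCenter T).Nontrivial → TopDyn.HasHorseshoe T) ∧
    (Nontrivial X → ¬ TopDyn.IsMinimalSystem T) :=
  ⟨hspec.isTopologicalK hT, (hspec.isTopologicalK hT).hasUPE, hspec.hasHorseshoe hT,
    hspec.not_isMinimalSystem hT⟩
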